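/- Let $\Omega\subset\mathbb R^2$ be convex and compact, let $X:=\Omega\cap\mathbb Z^2$, and let $\mathrm{Conv}(X)$ be the set of restrictions to $X$ of convex functions $U:\Omega\to\mathbb R$. A vector $e=(\alpha,\beta)\in\mathbb Z^2$ is irreducible if $\gcd(\alpha,\beta)=1$. If moreover $\|e\|>1$ (Euclidean norm), there is a unique pair $(f,g)\in(\mathbb Z^2)^2$ with $\det(f,g)=1$, $\langle f,g\rangle\ge 0$ and $e=f+g$; then $f,g$ are called the parents of $e$ (unit vectors have no parents). For $x\in X$, $u:X\to\mathbb R$ and irreducible $e$ (with $\|e\|>1$ and parents $f,g$ for $T$ and $P$) consider the linear forms $$S_x^e(u):=u(x+e)-2u(x)+u(x-e),$$ $$T_x^e(u):=u(x+e)+u(x-f)+u(x-g)-3u(x),$$ $$P_x^e(u):=u(x+e)-u(x+f)-u(x+g)+u(x);$$ such a form is supported on $X$ if all the points at which it evaluates $u$ belong to $X$. Let $\mathcal V_{\max}(x):=\{e\in\mathbb Z^2\text{ irreducible}: x+e\in X\}$. A family of stencils on $X$ is a collection $\mathcal V=(\mathcal V(x))_{x\in X}$ of sets $\mathcal V(x)\subset\mathcal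 V_{\max}(x)$ such that, for every $x\in X$, (Stability) any parent $f\in\mathcal V_{\max}(x)$ of any $e\in\mathcal V(x)$ belongs to $\mathcal V(x)$; (Visibility) $\mathcal V(x)$ and $\mathcal V_{\max}(x)$ generate the same convex cone in $\mathbb R^2$ (the empty set generating $\{0\}$). Let $\hat{\mathcal V}(x)$ be the set of those $e\in\mathcal V_{\max}(x)\setminus\mathcal V(x)$ with $\|e\|>1$ whose two parents belong to $\mathcal V(x)$. The cone $\mathrm{Conv}(\mathcal V)$ is the set of $u:X\to\mathbb R$ such that for all $x\in X$: $S_x^e(u)\ge0$ for all $e\in\mathcal V(x)$ with $S_x^e$ supported on $X$; $T_x^e(u)\ge 0$ for all $e\in\mathcal V(x)$ with $\|e\|>1$ and $T_x^e$ supported on $X$; and $P_x^e(u)\ge0$ for all $e\in\hat{\mathcal V}(x)$. Let $u\in\mathrm{Conv}(X)$. Then there is a smallest (for inclusion) family of stencils $\mathcal V$ on $X$ such that $u\in\mathrm{Conv}(\mathcal V)$, called the minimal stencils. For any $x\in X$ and any irreducible $e\in\mathbb Z^2$ with $\|e\|>1$ and $x+e\in X$, one has $$e\in\mathcal V(x)\iff\bigl(P_x^e\text{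 is not supported on }X,\ \text{or }P_x^e(u)<0\bigr).$$ -/

import Mathlib

noncomputable section

namespace DiscreteConvex

/-- The lattice of integer vectors of the plane. -/
abbrev Lattice : Type := ℤ × ℤ

/-- The Euclidean plane. -/
abbrev Plane : Type := EuclideanSpace ℝ (Fin 2)

/-- The inclusion of the lattice in the Euclidean plane. -/
def toPlane (z : Lattice) : Plane := !₂[(z.1 : ℝ), (z.2 : ℝ)]

/-- The grid `X`: the lattice points lying in the domain `Ω`. -/
def grid (Ω : Set Plane) : Set Lattice := {z | toPlane z ∈ Ω}

/-- A lattice vector is irreducible if its coordinates are coprime. -/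
def IsIrred (e : Lattice) : Prop := Int.gcd e.1 e.2 = 1

/-- The determinant of a pair of lattice vectors. -/
def det (f g : Lattice) : ℤ := f.1 * g.2 - f.2 * g.1

/-- The scalar product of two lattice vectors. -/
def dot (f g : Lattice) : ℤ := f.1 * g.1 + f.2 * g.2

/-- `p = (f, g)` is a direct acute basis of the lattice with `f + g = e`. -/
def IsParentPair (e : Lattice) (p : Lattice × Lattice) : Prop :=
  det p.1 p.2 = 1 ∧ 0 ≤ dot p.1 p.2 ∧ p.1 + p.2 = e

theorem norm_toPlane_sq (z : Lattice) : ‖toPlane z‖ ^ 2 = ((dot z z : ℤ) : ℝ) := by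
  simp [EuclideanSpace.norm_sq_eq, toPlane, dot, Fin.sum_univ_two]
  ring

theorem one_lt_norm_iff (z : Lattice) : 1 < ‖toPlane z‖ ↔ 1 < dot z z := by
  rw [← one_lt_sq_iff₀ (norm_nonneg _), norm_toPlane_sq]
  exact_mod_cast Iff.rfl

/-- Every irreducible vector of norm larger than one is in exactly one way the sum of the elements
of a direct acute basis. -/
theorem existsUnique_parentPair (e : Lattice) (he : IsIrred e) (hn : 1 < ‖toPlane e‖) :
    ∃! p : Lattice × Lattice, IsParentPair e p := by
  rw [one_lt_norm_iff] at hn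
  obtain ⟨a, b⟩ := e
  simp only [IsIrred, dot] at he hn
  have hcop : IsCoprime a b := Int.isCoprime_iff_gcd_eq_one.mpr he
  obtain ⟨r, s, hrs⟩ := hcop
  set N := a * a + b * b with hN
  -- shift a first solution of `det f e = 1` by a multiple of `e`
  have key : ∃ x y : ℤ, x * b - y * a = 1 ∧ 0 ≤ x * a + y * b ∧ x * a + y * b < N := by
    set k := (s * a - r * b) / N with hk
    refine ⟨s - k * a, -r - k * b, by linear_combination hrs, ?_, ?_⟩
    · have h1 := Int.emod_nonneg (s * a - r * b) (show N ≠ 0 by omega)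
      have h2 := Int.mul_ediv_add_emod (s * a - r * b) N
      nlinarith
    · have h1 := Int.emod_lt_of_pos (s * a - r * b) (show 0 < N by omega)
      have h2 := Int.mul_ediv_add_emod (s * a - r * b) N
      nlinarith
  obtain ⟨x, y, hd, h0, hlt⟩ := key
  have lag : (x * x + y * y) * N = (x * a + y * b) ^ 2 + 1 := by
    rw [hN]; linear_combination (x * b - y * a + 1) * hd
  have hpos : 0 < x * a + y * b := by
    rcases h0.lt_or_eq with h | h
    · exact h
    · exfalso
      rw [← h] at lag
      have : 0 < x * x + y * y := by
        by_contra hc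
        nlinarith
      nlinarith
  refine ⟨((x, y), (a - x, b - y)), ⟨?_, ?_, ?_⟩, ?_⟩
  · simp only [det]; linear_combination hd
  · simp only [dot]
    have : 0 ≤ (x * (a - x) + y * (b - y)) * N := by nlinarith
    exact nonneg_of_mul_nonneg_left this (by omega)
  · simp
  · rintro ⟨⟨x', y'⟩, ⟨z', w'⟩⟩ ⟨h1, h2, h3⟩
    simp only [det, dot, Prod.mk_add_mk, Prod.mk.injEq] at h1 h2 h3
    obtain ⟨h3, h4⟩ := h3
    obtain rfl : z' = a - x' := by omega
    obtain rfl : w' = b - y' := by omega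
    have hd' : x' * b - y' * a = 1 := by linear_combination h1
    -- the two solutions differ by a multiple of `e`
    obtain ⟨k, hx, hy⟩ : ∃ k : ℤ, x' = x + k * a ∧ y' = y + k * b :=
      ⟨r * (x' - x) + s * (y' - y), by linear_combination (-(x' - x)) * hrs + s * (hd' - hd),
        by linear_combination (-(y' - y)) * hrs - r * (hd' - hd)⟩
    have hs' : 0 < x' * a + y' * b := by
      have : x' ≠ 0 ∨ y' ≠ 0 := by
        by_contra hc
        push Not at hc
        rw [hc.1, hc.2] at hd'
        simp at hd'
      rcases this with h | h <;> nlinarith [sq_nonneg x', sq_nonneg y', mul_self_pos.mpr h]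
    have hs'' : x' * a + y' * b < N := by
      have : a - x' ≠ 0 ∨ b - y' ≠ 0 := by
        by_contra hc
        push Not at hc
        rw [hc.1, hc.2] at h1
        simp at h1
      rcases this with h | h <;>
        nlinarith [sq_nonneg (a - x'), sq_nonneg (b - y'), mul_self_pos.mpr h]
    have hk : x' * a + y' * b = x * a + y * b + k * N := by rw [hx, hy, hN]; ring
    have hk0 : k = 0 := by
      rcases lt_trichotomy k 0 with h | h | h
      · nlinarith
      · exact h
      · nlinarith
    subst hk0
    simp [hx, hy]

open Classical in
/-- The parents `(f, g)` of an irreducible vector `e` of norm larger than one: the unique direct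
acute basis with `f + g = e`. The value `0` for other vectors is never used. -/
def parents (e : Lattice) : Lattice × Lattice :=
  if h : IsIrred e ∧ 1 < ‖toPlane e‖ then (existsUnique_parentPair e h.1 h.2).choose else 0

theorem parents_spec {e : Lattice} (he : IsIrred e) (hn : 1 < ‖toPlane e‖) :
    IsParentPair e (parents e) := by
  rw [parents, dif_pos ⟨he, hn⟩]
  exact (existsUnique_parentPair e he hn).choose_spec.1

/-- Finite weighted sums of Dirac masses on the lattice, seen as linear forms on the functions of a
lattice point; the support of such a form `L` is `L.support`. -/
abbrev Form : Type := Lattice →₀ ℝ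

/-- The Dirac mass at `z`. -/
def dirac (z : Lattice) : Form := Finsupp.single z 1

/-- The segment form `u (x + e) - 2 u x + u (x - e)`. -/
def segForm (x e : Lattice) : Form :=
  dirac (x + e) - (2 : ℝ) • dirac x + dirac (x - e)

/-- The triangle form `u (x + e) + u (x - f) + u (x - g) - 3 u x`, where `f, g` are the parents
of `e`. -/
def triForm (x e : Lattice) : Form :=
  dirac (x + e) + dirac (x - (parents e).1) + dirac (x - (parents e).2) - (3 : ℝ) • dirac x

/-- The parallelogram form `u (x + e) - u (x + f) - u (x + g) + u x`, where `f, g` are the parents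
of `e`. -/
def parForm (x e : Lattice) : Form :=
  dirac (x + e) - dirac (x + (parents e).1) - dirac (x + (parents e).2) + dirac x

/-- The form `L` is supported on the set `X`. -/
def SupportedOn (L : Form) (X : Set Lattice) : Prop := (L.support : Set Lattice) ⊆ X

/-- The value `L(u)` of a form at a function `u` on `X`. It is meaningful if `L` is supported
on `X`, and then does not depend on the extension (by zero) of `u` used here. -/
def evalForm {X : Set Lattice} (L : Form) (u : X → ℝ) : ℝ :=
  Finsupp.linearCombination ℝ (Function.extend (Subtype.val : X → Lattice) u 0) L

/-- The cone `Conv(X)` of the restrictions to the grid of convex functions on `Ω`. -/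
def convGrid (Ω : Set Plane) : Set (grid Ω → ℝ) :=
  {u | ∃ U : Plane → ℝ, ConvexOn ℝ Ω U ∧ ∀ x : grid Ω, u x = U (toPlane x)}

/-- The maximal stencil at `x`. -/
def maxStencil (Ω : Set Plane) (x : grid Ω) : Set Lattice :=
  {e | IsIrred e ∧ (x : Lattice) + e ∈ grid Ω}

/-- `V` is a family of stencils on the grid of `Ω`. -/
structure IsStencils (Ω : Set Plane) (V : grid Ω → Set Lattice) : Prop where
  subset_max : ∀ x, V x ⊆ maxStencil Ω x
  /-- Stability: a stencil contains those parents of its members that lie in the maximal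
  stencil (unit vectors have no parents). -/
  stability : ∀ x, ∀ e ∈ V x, 1 < ‖toPlane e‖ → ∀ f ∈ maxStencil Ω x,
    (f = (parents e).1 ∨ f = (parents e).2) → f ∈ V x
  /-- Visibility: a stencil generates the same convex cone as the maximal stencil. -/
  visibility : ∀ x,
    PointedCone.hull ℝ (toPlane '' V x) = PointedCone.hull ℝ (toPlane '' maxStencil Ω x)

/-- The candidates for refinement at `x`: the vectors of the maximal stencil outside `V x` whose
two parents belong to `V x`. -/
def candidates (Ω : Set Plane) (V : grid Ω → Set Lattice) (x : grid Ω) : Set Lattice :=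
  {e | e ∈ maxStencil Ω x ∧ e ∉ V x ∧ 1 < ‖toPlane e‖ ∧
    (parents e).1 ∈ V x ∧ (parents e).2 ∈ V x}

/-- The cone `Conv(V)` attached to a family `V` of stencils. -/
def convStencils (Ω : Set Plane) (V : grid Ω → Set Lattice) : Set (grid Ω → ℝ) :=
  {u | ∀ x : grid Ω,
    (∀ e ∈ V x, SupportedOn (segForm x e) (grid Ω) → 0 ≤ evalForm (segForm x e) u) ∧
    (∀ e ∈ V x, 1 < ‖toPlane e‖ → SupportedOn (triForm x e) (grid Ω) →
      0 ≤ evalForm (triForm x e) u) ∧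
    (∀ e ∈ candidates Ω V x, 0 ≤ evalForm (parForm x e) u)}

/-- `V` is the minimal family of stencils with `u ∈ Conv(V)`: the smallest one for (pointwise)
inclusion. -/
def IsMinimalStencils (Ω : Set Plane) (u : grid Ω → ℝ) (V : grid Ω → Set Lattice) : Prop :=
  IsLeast {W : grid Ω → Set Lattice | IsStencils Ω W ∧ u ∈ convStencils Ω W} V

end DiscreteConvex

end

namespace DiscreteConvex

/-! ### Arithmetic of lattice vectors -/

/-! The minimal family is explicit: `activeStencil` keeps the unit vectors and the vectors
satisfying the asserted criterion. It remains to show that this family is admissible and is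
contained in every admissible one.

Admissibility. A vector outside it has both parents in the maximal stencil, so induction on the norm
gives visibility. Stability is inheritance: if the parallelogram form of `f` is supported and
nonnegative, so is that of any `e` having `f` as a parent (`parallelogram_step`). Convexity of `u`
gives the segment and triangle inequalities, and the parallelogram ones hold outside the family by
construction.

Minimality. Let `W` be admissible and let `e` in the maximal stencil be missing from `W x`. By
visibility `e` lies strictly between two members `p`, `q` of `W x` (`exists_between_of_mem_hull`).
While `det p q > 1`, a parent of the longer one cuts their cone and belongs to `W x` by stability
(`exists_parent_between`), so the pair can be taken of determinant one. A Stern-Brocot descent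
towards `e` then meets a sum `f + g` missing from `W x` with `f`, `g` in it. Stability of `W` forces
`f`, `g` to be an acute basis, so `f + g` is a candidate and its parallelogram form is nonnegative.
By inheritance no vector of the open cone of `f`, `g` is active, in particular not `e`. -/

theorem irred_of_det_eq_one {f g : Lattice} (h : det f g = 1) : IsIrred f ∧ IsIrred g := by
  simp only [det] at h
  exact ⟨Int.isCoprime_iff_gcd_eq_one.mp ⟨g.2, -g.1, by linarith⟩,
    Int.isCoprime_iff_gcd_eq_one.mp ⟨-f.2, f.1, by linarith⟩⟩

theorem one_le_dot_self {e : Lattice} (he : e ≠ 0) : 1 ≤ dot e e := by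
  obtain ⟨a, b⟩ := e
  simp only [dot]
  have h : a ≠ 0 ∨ b ≠ 0 := by
    by_contra hc
    push Not at hc
    exact he (by rw [hc.1, hc.2]; rfl)
  rcases h with h | h <;> nlinarith [mul_self_pos.mpr h, mul_self_nonneg a, mul_self_nonneg b]

theorem IsIrred.ne_zero {e : Lattice} (he : IsIrred e) : e ≠ 0 := by
  rintro rfl
  simp [IsIrred] at he

theorem exists_eq_smul_of_det_eq_zero {v e : Lattice} (he : IsIrred e) (h : det v e = 0) :
    ∃ m : ℤ, v = m • e := by
  obtain ⟨r, s, hrs⟩ := Int.isCoprime_iff_gcd_eq_one.mpr he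
  simp only [det] at h
  refine ⟨r * v.1 + s * v.2, Prod.ext ?_ ?_⟩
  · simp only [Prod.smul_fst, smul_eq_mul]
    linear_combination (-v.1) * hrs + s * h
  · simp only [Prod.smul_snd, smul_eq_mul]
    linear_combination (-v.2) * hrs - r * h

theorem IsIrred.isUnit_of_eq_smul {p e : Lattice} {m : ℤ} (hp : IsIrred p) (h : p = m • e) :
    m = 1 ∨ m = -1 := by
  subst h
  simp only [IsIrred, Prod.smul_fst, Prod.smul_snd, smul_eq_mul, Int.gcd_mul_left] at hp
  have := Nat.eq_one_of_mul_eq_one_right hp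
  omega

theorem eq_or_eq_neg_of_det_eq_zero {p e : Lattice} (hp : IsIrred p) (he : IsIrred e)
    (h : det p e = 0) : p = e ∨ p = -e := by
  obtain ⟨m, hm⟩ := exists_eq_smul_of_det_eq_zero he h
  rcases hp.isUnit_of_eq_smul hm with rfl | rfl
  · left; simpa using hm
  · right; simpa using hm

theorem eq_of_det_eq_zero {p e v : Lattice} (hp : IsIrred p) (he : IsIrred e) (h : det p e = 0)
    (h1 : 0 < det v p) (h2 : 0 < det v e) : p = e := by
  rcases eq_or_eq_neg_of_det_eq_zero hp he h with h | h
  · exact h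
  · subst h
    simp only [det, Prod.fst_neg, Prod.snd_neg] at h1 h2
    nlinarith

/-- Coordinates with respect to a direct basis. -/
theorem eq_smul_add_smul {f g : Lattice} (h : det f g = 1) (e : Lattice) :
    e = det e g • f + det f e • g := by
  simp only [det] at *
  refine Prod.ext ?_ ?_
  · simp only [Prod.fst_add, Prod.smul_fst, smul_eq_mul]
    linear_combination (-e.1) * h
  · simp only [Prod.snd_add, Prod.smul_snd, smul_eq_mul]
    linear_combination (-e.2) * h

/-! ### Parents -/

namespace IsParentPair

variable {e f g : Lattice}

theorem det_left (h : IsParentPair e (f, g)) : det f e = 1 := by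
  obtain ⟨h1, -, rfl⟩ := h
  simp only [det, Prod.fst_add, Prod.snd_add] at *
  linarith

theorem det_right (h : IsParentPair e (f, g)) : det e g = 1 := by
  obtain ⟨h1, -, rfl⟩ := h
  simp only [det, Prod.fst_add, Prod.snd_add] at *
  linarith

theorem irred (h : IsParentPair e (f, g)) : IsIrred e := (irred_of_det_eq_one h.det_left).2

theorem irred_left (h : IsParentPair e (f, g)) : IsIrred f := (irred_of_det_eq_one h.1).1

theorem irred_right (h : IsParentPair e (f, g)) : IsIrred g := (irred_of_det_eq_one h.1).2

theorem dot_left_pos (h : IsParentPair e (f, g)) : 0 < dot f e := by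
  have hf := one_le_dot_self h.irred_left.ne_zero
  obtain ⟨-, h2, rfl⟩ := h
  simp only [dot, Prod.fst_add, Prod.snd_add] at *
  linarith

theorem dot_right_pos (h : IsParentPair e (f, g)) : 0 < dot g e := by
  have hf := one_le_dot_self h.irred_right.ne_zero
  obtain ⟨-, h2, rfl⟩ := h
  simp only [dot, Prod.fst_add, Prod.snd_add] at *
  linarith

theorem dot_add (h : IsParentPair e (f, g)) : dot f e + dot g e = dot e e := by
  obtain ⟨-, -, rfl⟩ := h
  simp only [dot, Prod.fst_add, Prod.snd_add]
  ring

theorem dot_left_lt (h : IsParentPair e (f, g)) : dot f f < dot e e := by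
  have hf := one_le_dot_self h.irred_right.ne_zero
  obtain ⟨-, h2, rfl⟩ := h
  simp only [dot, Prod.fst_add, Prod.snd_add] at *
  linarith

theorem dot_right_lt (h : IsParentPair e (f, g)) : dot g g < dot e e := by
  have hf := one_le_dot_self h.irred_left.ne_zero
  obtain ⟨-, h2, rfl⟩ := h
  simp only [dot, Prod.fst_add, Prod.snd_add] at *
  linarith

theorem one_lt_norm (h : IsParentPair e (f, g)) : 1 < ‖toPlane e‖ := by
  rw [one_lt_norm_iff]
  exact (one_le_dot_self h.irred_left.ne_zero).trans_lt h.dot_left_lt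

theorem parents_eq (h : IsParentPair e (f, g)) : parents e = (f, g) :=
  (existsUnique_parentPair e h.irred h.one_lt_norm).unique
    (parents_spec h.irred h.one_lt_norm) h

/-- The right element of an acute basis is obtained from the right parent of the left one by
adding a multiple of the latter. -/
theorem exists_right_eq {f₁ f₂ : Lattice} (h : IsParentPair e (f, g))
    (hf : IsParentPair f (f₁, f₂)) : ∃ k : ℤ, 0 ≤ k ∧ g = k • f + f₂ := by
  obtain ⟨m, hm⟩ := exists_eq_smul_of_det_eq_zero (v := g - f₂) h.irred_left (by
    have h1 := h.1
    have h2 := hf.det_right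
    simp only [det, Prod.fst_sub, Prod.snd_sub] at *
    linarith)
  refine ⟨m, ?_, by rw [← hm]; abel⟩
  have h1 : dot f g = m * dot f f + dot f₂ f := by
    rw [show g = m • f + f₂ by rw [← hm]; abel]
    simp only [dot, Prod.fst_add, Prod.snd_add, Prod.smul_fst, Prod.smul_snd, smul_eq_mul]
    ring
  have h2 : 0 ≤ dot f g := h.2.1
  have h3 := hf.dot_left_pos
  have h4 := hf.dot_add
  have h5 := hf.dot_right_pos
  -- The scalar product of `f₂` and `f` is smaller than that of `f` with itself, so a multiplier `m
  -- ≤ -1` would make `dot f g` negative.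
  by_contra hc
  nlinarith

/-- The left element of an acute basis is obtained from the left parent of the right one by
adding a multiple of the latter. -/
theorem exists_left_eq {g₁ g₂ : Lattice} (h : IsParentPair e (f, g))
    (hg : IsParentPair g (g₁, g₂)) : ∃ k : ℤ, 0 ≤ k ∧ f = k • g + g₁ := by
  obtain ⟨m, hm⟩ := exists_eq_smul_of_det_eq_zero (v := f - g₁) h.irred_right (by
    have h1 := h.1
    have h2 := hg.det_left
    simp only [det, Prod.fst_sub, Prod.snd_sub] at *
    linarith)
  refine ⟨m, ?_, by rw [← hm]; abel⟩
  have h1 : dot f g = m * dot g g + dot g₁ g := by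
    rw [show f = m • g + g₁ by rw [← hm]; abel]
    simp only [dot, Prod.fst_add, Prod.snd_add, Prod.smul_fst, Prod.smul_snd, smul_eq_mul]
    ring
  have h2 : 0 ≤ dot f g := h.2.1
  have h3 := hg.dot_left_pos
  have h4 := hg.dot_add
  have h5 := hg.dot_right_pos
  by_contra hc
  nlinarith

theorem add_left (h : IsParentPair e (f, g)) : IsParentPair (e + g) (e, g) :=
  ⟨h.det_right, by have := h.dot_right_pos; simp only [dot] at *; linarith, rfl⟩

theorem add_right (h : IsParentPair e (f, g)) : IsParentPair (f + e) (f, e) :=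
  ⟨h.det_left, h.dot_left_pos.le, rfl⟩

end IsParentPair

/-- Position of a parent `p` of `e` relative to a shorter irreducible vector `s` lying on the same
side of `e`. The sign `σ` tells this side. -/
theorem exists_smul_parent_eq {s e p : Lattice} {σ d : ℤ} (hs : IsIrred s) (he : IsIrred e)
    (hσ : σ * σ = 1) (hd : 0 < d) (hse : det s e = σ * d) (hpe : det p e = σ)
    (h0 : 0 < dot p e) (h1 : dot p e < dot e e) (hle : dot s s ≤ dot e e) :
    ∃ m : ℤ, d • p = s + m • e ∧ (1 < d → 0 < m ∧ m < d) ∧ (d = 1 → dot s e < 0 → m = 1) := by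
  obtain ⟨m, hm⟩ := exists_eq_smul_of_det_eq_zero (v := d • p - s) he (by
    simp only [det, Prod.fst_sub, Prod.snd_sub, Prod.smul_fst, Prod.smul_snd, smul_eq_mul] at *
    linear_combination d * hpe - hse)
  have hp : d • p = s + m • e := by rw [← hm]; abel
  have hdot : d * dot p e = dot s e + m * dot e e := by
    have e1 := congrArg Prod.fst hp
    have e2 := congrArg Prod.snd hp
    simp only [dot, Prod.fst_add, Prod.snd_add, Prod.smul_fst, Prod.smul_snd, smul_eq_mul] at *
    linear_combination e.1 * e1 + e.2 * e2
  -- Lagrange's identity: as `s` is no longer than `e` and `d > 0`, it gives `|dot s e| < dot e e`.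
  -- With `hdot` this confines `m` to the range from `0` to `d`.
  have lag : dot s e * dot s e + d * d = dot s s * dot e e := by
    have : dot s e * dot s e + det s e * det s e = dot s s * dot e e := by
      simp only [dot, det]; ring
    rw [hse] at this
    linear_combination this - d * d * hσ
  have hee := one_le_dot_self he.ne_zero
  have habs : |dot s e| < dot e e := by
    refine abs_lt_of_sq_lt_sq ?_ (by linarith)
    nlinarith
  obtain ⟨ha, hb⟩ := abs_lt.mp habs
  have hm0 : 0 ≤ m := by
    by_contra hc
    nlinarith
  have hmd : m ≤ d := by
    by_contra hc
    nlinarith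
  -- For `d > 1` an endpoint value of `m` would make `s` equal to `d` times a lattice vector,
  -- contradicting irreducibility.
  refine ⟨m, hp, fun hd1 => ⟨hm0.lt_of_ne ?_, hmd.lt_of_ne ?_⟩, ?_⟩
  · rintro rfl
    have := hs.isUnit_of_eq_smul (m := d) (e := p) (by rw [hp]; simp)
    omega
  · rintro rfl
    have := hs.isUnit_of_eq_smul (m := m) (e := p - e) (by rw [smul_sub, hp]; abel)
    omega
  · rintro rfl hneg
    have : m ≠ 0 := by
      rintro rfl
      linarith
    omega

/-! ### Convexity on the grid -/

/-- The extension by zero of a function on the grid. -/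
noncomputable def extendZero {X : Set Lattice} (u : X → ℝ) : Lattice → ℝ :=
  Function.extend (Subtype.val : X → Lattice) u 0

section Convexity

variable {Ω : Set Plane} {u : grid Ω → ℝ}

theorem toPlane_eq_of_weights {p q r z : Lattice} {a b c : ℤ} (habc : 0 < a + b + c)
    (h : (a + b + c) • z = a • p + b • q + c • r) :
    toPlane z = ((a : ℝ) / (a + b + c)) • toPlane p + ((b : ℝ) / (a + b + c)) • toPlane q +
      ((c : ℝ) / (a + b + c)) • toPlane r := by
  have hn : (0 : ℝ) < a + b + c := by exact_mod_cast habc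
  have e1 := congrArg Prod.fst h
  have e2 := congrArg Prod.snd h
  simp only [Prod.fst_add, Prod.snd_add, Prod.smul_fst, Prod.smul_snd, smul_eq_mul] at e1 e2
  have e1' : ((a : ℝ) + b + c) * z.1 = a * p.1 + b * q.1 + c * r.1 := by exact_mod_cast e1
  have e2' : ((a : ℝ) + b + c) * z.2 = a * p.2 + b * q.2 + c * r.2 := by exact_mod_cast e2
  ext i
  fin_cases i
  · simp [toPlane]
    field_simp
    linarith
  · simp [toPlane]
    field_simp
    linarith

/-- Integer weights keep barycentric identities inside the lattice. Segments are covered by giving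
the third point weight zero. -/
theorem mem_grid_of_weights (hΩ : Convex ℝ Ω) {p q r z : Lattice} (hp : p ∈ grid Ω)
    (hq : q ∈ grid Ω) (hr : r ∈ grid Ω) {a b c : ℤ} (ha : 0 ≤ a) (hb : 0 ≤ b) (hc : 0 ≤ c)
    (habc : 0 < a + b + c) (h : (a + b + c) • z = a • p + b • q + c • r) : z ∈ grid Ω := by
  have hn : (0 : ℝ) < a + b + c := by exact_mod_cast habc
  have ha' : (0 : ℝ) ≤ a := by exact_mod_cast ha
  have hb' : (0 : ℝ) ≤ b := by exact_mod_cast hb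
  have hc' : (0 : ℝ) ≤ c := by exact_mod_cast hc
  have key := hΩ.sum_mem (t := Finset.univ) (z := ![toPlane p, toPlane q, toPlane r])
    (w := ![(a : ℝ) / (a + b + c), (b : ℝ) / (a + b + c), (c : ℝ) / (a + b + c)])
    (by intro i _; fin_cases i <;> simp <;> positivity)
    (by simp [Fin.sum_univ_three]; field_simp)
    (by intro i _; fin_cases i; exacts [hp, hq, hr])
  simp only [Fin.sum_univ_three, Matrix.cons_val] at key
  rw [← toPlane_eq_of_weights habc h] at key
  exact key

theorem extendZero_le_of_weights (hu : u ∈ convGrid Ω) {p q r z : Lattice} (hp : p ∈ grid Ω)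
    (hq : q ∈ grid Ω) (hr : r ∈ grid Ω) {a b c : ℤ} (ha : 0 ≤ a) (hb : 0 ≤ b) (hc : 0 ≤ c)
    (habc : 0 < a + b + c) (h : (a + b + c) • z = a • p + b • q + c • r) :
    ((a : ℝ) + b + c) * extendZero u z ≤
      a * extendZero u p + b * extendZero u q + c * extendZero u r := by
  obtain ⟨U, hU, hUu⟩ := hu
  have ext_eq : ∀ y ∈ grid Ω, extendZero u y = U (toPlane y) := fun y hy =>
    (Subtype.val_injective.extend_apply u 0 ⟨y, hy⟩).trans (hUu ⟨y, hy⟩)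
  have hz := mem_grid_of_weights hU.1 hp hq hr ha hb hc habc h
  rw [ext_eq p hp, ext_eq q hq, ext_eq r hr, ext_eq z hz]
  have hn : (0 : ℝ) < a + b + c := by exact_mod_cast habc
  have ha' : (0 : ℝ) ≤ a := by exact_mod_cast ha
  have hb' : (0 : ℝ) ≤ b := by exact_mod_cast hb
  have hc' : (0 : ℝ) ≤ c := by exact_mod_cast hc
  have key := hU.map_sum_le (t := Finset.univ) (p := ![toPlane p, toPlane q, toPlane r])
    (w := ![(a : ℝ) / (a + b + c), (b : ℝ) / (a + b + c), (c : ℝ) / (a + b + c)])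
    (by intro i _; fin_cases i <;> simp <;> positivity)
    (by simp [Fin.sum_univ_three]; field_simp)
    (by intro i _; fin_cases i; exacts [hp, hq, hr])
  simp only [Fin.sum_univ_three, Matrix.cons_val, smul_eq_mul] at key
  rw [← toPlane_eq_of_weights habc h] at key
  calc ((a : ℝ) + b + c) * U (toPlane z)
      ≤ (a + b + c) * (a / (a + b + c) * U (toPlane p) + b / (a + b + c) * U (toPlane q) +
        c / (a + b + c) * U (toPlane r)) := by gcongr
    _ = _ := by field_simp

/-! ### Evaluation and support of the forms -/

theorem evalForm_segForm (x e : Lattice) :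
    evalForm (segForm x e) u =
      extendZero u (x + e) - 2 * extendZero u x + extendZero u (x - e) := by
  simp [evalForm, segForm, dirac, extendZero]

theorem evalForm_triForm {x e f g : Lattice} (h : IsParentPair e (f, g)) :
    evalForm (triForm x e) u = extendZero u (x + e) + extendZero u (x - f) +
      extendZero u (x - g) - 3 * extendZero u x := by
  simp [evalForm, triForm, dirac, extendZero, h.parents_eq]

theorem evalForm_parForm {x e f g : Lattice} (h : IsParentPair e (f, g)) :
    evalForm (parForm x e) u = extendZero u (x + e) - extendZero u (x + f) -
      extendZero u (x + g) + extendZero u x := by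
  simp [evalForm, parForm, dirac, extendZero, h.parents_eq]

theorem SupportedOn.mem {L : Form} {X : Set Lattice} (h : SupportedOn L X) {z : Lattice}
    (hz : L z ≠ 0) : z ∈ X := h (by simpa using hz)

/-- The Dirac masses sit at distinct points, so none of them cancels in the support; the same check
is needed for the other two forms. -/
theorem mem_of_supportedOn_segForm {X : Set Lattice} {x e : Lattice} (he : IsIrred e)
    (h : SupportedOn (segForm x e) X) : x + e ∈ X ∧ x - e ∈ X := by
  have h0 := he.ne_zero
  have h1 : x - e ≠ x + e := by
    intro hc
    apply h0
    have e1 := congrArg Prod.fst hc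
    have e2 := congrArg Prod.snd hc
    simp only [Prod.fst_add, Prod.snd_add, Prod.fst_sub, Prod.snd_sub] at e1 e2
    exact Prod.ext (by simp; omega) (by simp; omega)
  have h2 : x ≠ x + e := by simpa using h0
  have h3 : x ≠ x - e := fun hc => h0 (sub_eq_self.mp hc.symm)
  constructor
  · exact h.mem (by simp [segForm, dirac, h1, h0])
  · exact h.mem (by simp [segForm, dirac, h1.symm, h3])

theorem mem_of_supportedOn_triForm {X : Set Lattice} {x e f g : Lattice}
    (hp : IsParentPair e (f, g)) (h : SupportedOn (triForm x e) X) :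
    x + e ∈ X ∧ x - f ∈ X ∧ x - g ∈ X := by
  have hf := hp.irred_left.ne_zero
  have hg := hp.irred_right.ne_zero
  have he := hp.irred.ne_zero
  have h1 : x + e ≠ x - f := by
    intro hc
    have hef : e = -f := by rw [sub_eq_add_neg] at hc; exact add_left_cancel hc
    have := hp.det_left
    rw [hef] at this
    simp only [det, Prod.fst_neg, Prod.snd_neg] at this
    nlinarith
  have h2 : x + e ≠ x - g := by
    intro hc
    have hef : e = -g := by rw [sub_eq_add_neg] at hc; exact add_left_cancel hc
    have := hp.det_right
    rw [hef] at this
    simp only [det, Prod.fst_neg, Prod.snd_neg] at this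
    nlinarith
  have h3 : x - f ≠ x - g := by
    intro hc
    have hef : f = g := sub_right_injective hc
    have := hp.1
    rw [hef] at this
    simp only [det] at this
    nlinarith
  have h5 : x ≠ x - f := fun hc => hf (sub_eq_self.mp hc.symm)
  have h6 : x ≠ x - g := fun hc => hg (sub_eq_self.mp hc.symm)
  refine ⟨h.mem ?_, h.mem ?_, h.mem ?_⟩ <;>
    simp only [triForm, dirac, hp.parents_eq, Finsupp.add_apply, Finsupp.sub_apply,
      Finsupp.smul_apply, Finsupp.single_apply]
  · simp [h1.symm, h2.symm, he]
  · simp [h1, h3.symm, h5]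
  · simp [h2, h3, h6]

theorem supportedOn_parForm_iff {X : Set Lattice} {x e f g : Lattice} (hx : x ∈ X)
    (hxe : x + e ∈ X) (hp : IsParentPair e (f, g)) :
    SupportedOn (parForm x e) X ↔ x + f ∈ X ∧ x + g ∈ X := by
  have hf := hp.irred_left.ne_zero
  have hg := hp.irred_right.ne_zero
  have hsum : f + g = e := hp.2.2
  have h1 : x + e ≠ x + f := by
    rw [← hsum]; simpa using hg
  have h2 : x + e ≠ x + g := by
    rw [← hsum]; simpa using hf
  have h3 : x + f ≠ x + g := by
    intro hc
    have hef : f = g := add_left_cancel hc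
    have := hp.1
    rw [hef] at this
    simp only [det] at this
    nlinarith
  have h5 : x ≠ x + f := by simpa using hf
  have h6 : x ≠ x + g := by simpa using hg
  constructor
  · intro h
    refine ⟨h.mem ?_, h.mem ?_⟩ <;>
      simp only [parForm, dirac, hp.parents_eq, Finsupp.add_apply, Finsupp.sub_apply,
        Finsupp.single_apply]
    · simp [h1, h3.symm, h5]
    · simp [h2, h3, h6]
  · rintro ⟨hxf, hxg⟩ z hz
    by_contra hc
    have n1 : x + e ≠ z := fun hh => hc (hh ▸ hxe)
    have n2 : x + f ≠ z := fun hh => hc (hh ▸ hxf)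
    have n3 : x + g ≠ z := fun hh => hc (hh ▸ hxg)
    have n4 : x ≠ z := fun hh => hc (hh ▸ hx)
    rw [Finset.mem_coe, Finsupp.mem_support_iff] at hz
    apply hz
    simp only [parForm, dirac, hp.parents_eq, Finsupp.add_apply, Finsupp.sub_apply,
        Finsupp.single_apply]
    rw [if_neg n1, if_neg n2, if_neg n3, if_neg n4]
    norm_num

theorem evalForm_segForm_nonneg (hu : u ∈ convGrid Ω) {x e : Lattice} (he : IsIrred e)
    (h : SupportedOn (segForm x e) (grid Ω)) : 0 ≤ evalForm (segForm x e) u := by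
  obtain ⟨h1, h2⟩ := mem_of_supportedOn_segForm he h
  have := extendZero_le_of_weights hu (z := x) h1 h2 h2 (a := 1) (b := 1) (c := 0) (by norm_num)
    (by norm_num) (by norm_num) (by norm_num) (by module)
  rw [evalForm_segForm]
  push_cast at this
  linarith

theorem evalForm_triForm_nonneg (hu : u ∈ convGrid Ω) {x e f g : Lattice}
    (hp : IsParentPair e (f, g)) (h : SupportedOn (triForm x e) (grid Ω)) :
    0 ≤ evalForm (triForm x e) u := by
  obtain ⟨h1, h2, h3⟩ := mem_of_supportedOn_triForm hp h
  have hsum : f + g = e := hp.2.2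
  have := extendZero_le_of_weights hu (z := x) h1 h2 h3 (a := 1) (b := 1) (c := 1) (by norm_num)
    (by norm_num) (by norm_num) (by norm_num) (by rw [← hsum]; module)
  rw [evalForm_triForm hp]
  push_cast at this
  linarith

/-! ### The stencils selected by a convex function -/

/-- The vectors of the maximal stencil whose parallelogram form is not supported on the grid or
negative at `u`, and the unit vectors of the maximal stencil. -/
def activeStencil (Ω : Set Plane) (u : grid Ω → ℝ) (x : grid Ω) : Set Lattice :=
  {e | e ∈ maxStencil Ω x ∧ (1 < ‖toPlane e‖ →
    ¬ SupportedOn (parForm x e) (grid Ω) ∨ evalForm (parForm x e) u < 0)}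

theorem notMem_activeStencil_iff {x : grid Ω} {e f g : Lattice} (he : e ∈ maxStencil Ω x)
    (hp : IsParentPair e (f, g)) :
    e ∉ activeStencil Ω u x ↔ (x + f ∈ grid Ω ∧ x + g ∈ grid Ω) ∧
      extendZero u (x + f) + extendZero u (x + g) ≤ extendZero u (x + e) + extendZero u x := by
  simp only [activeStencil, Set.mem_ofPred_eq, he, hp.one_lt_norm, true_and, forall_true_left,
    supportedOn_parForm_iff x.2 he.2 hp, evalForm_parForm hp, not_or, not_not, not_lt]
  refine and_congr_right fun _ => ?_
  constructor <;> intro h <;> linarith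

/-- Nonnegativity of a parallelogram form passes to the children. -/
theorem parallelogram_step (hu : u ∈ convGrid Ω) {x h h' f g e : Lattice} {k : ℤ} (hk : 0 ≤ k)
    (hf : f = h + h') (hg : g = k • f + h) (he : e = f + g) (hxh : x + h ∈ grid Ω)
    (hxh' : x + h' ∈ grid Ω) (hxe : x + e ∈ grid Ω)
    (hle : extendZero u (x + h) + extendZero u (x + h') ≤ extendZero u (x + f) + extendZero u x) :
    x + g ∈ grid Ω ∧
      extendZero u (x + f) + extendZero u (x + g) ≤ extendZero u (x + e) + extendZero u x := by
  have hΩ : Convex ℝ Ω := hu.choose_spec.1.1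
  -- The points `x + h`, `x + f + h`, `x + g`, `x + e` lie on a line of direction `f`, and `x + f`
  -- is the midpoint of `x + h'` and `x + f + h`.
  have w1 : (1 + k + 0) • (x + g) = (1 : ℤ) • (x + h) + k • (x + e) + (0 : ℤ) • (x + e) := by
    rw [he, hg]; module
  have w2 : (k + 1 + 0) • (x + f + h) = k • (x + h) + (1 : ℤ) • (x + e) + (0 : ℤ) • (x + e) := by
    rw [he, hg]; module
  have w3 : ((1 : ℤ) + 1 + 0) • (x + f) =
      (1 : ℤ) • (x + h') + (1 : ℤ) • (x + f + h) + (0 : ℤ) • (x + f + h) := by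
    rw [hf]; module
  have hfh : x + f + h ∈ grid Ω :=
    mem_grid_of_weights hΩ hxh hxe hxe hk zero_le_one le_rfl (by omega) w2
  refine ⟨mem_grid_of_weights hΩ hxh hxe hxe zero_le_one hk le_rfl (by omega) w1, ?_⟩
  have i1 := extendZero_le_of_weights hu hxh hxe hxe zero_le_one hk le_rfl (by omega) w1
  have i2 := extendZero_le_of_weights hu hxh hxe hxe hk zero_le_one le_rfl (by omega) w2
  have i3 := extendZero_le_of_weights hu hxh' hfh hfh zero_le_one zero_le_one le_rfl
    (by norm_num) w3
  push_cast at i1 i2 i3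
  have hk' : (0 : ℝ) < k + 1 := by exact_mod_cast Int.lt_add_one_of_le hk
  -- The inner points `x + g` and `x + f + h` have the same sum as the endpoints `x + h` and `x +
  -- e`, so `i1` and `i2` add up to this inequality, multiplied by `k + 1`.
  have i4 : extendZero u (x + g) + extendZero u (x + f + h) ≤
      extendZero u (x + h) + extendZero u (x + e) := by
    refine le_of_mul_le_mul_left ?_ hk'
    linarith
  linarith

theorem exists_parentPair {e : Lattice} (he : IsIrred e) (hn : 1 < ‖toPlane e‖) :
    ∃ f g, IsParentPair e (f, g) := ⟨_, _, parents_spec he hn⟩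

/-- Contrapositive of `parallelogram_step`: an inactive parent makes its child inactive. The other
parent has the form that step requires because the basis is acute. -/
theorem activeStencil_stable (hu : u ∈ convGrid Ω) {x : grid Ω} {e f g : Lattice}
    (he : e ∈ activeStencil Ω u x) (hp : IsParentPair e (f, g)) :
    (f ∈ maxStencil Ω x → f ∈ activeStencil Ω u x) ∧
      (g ∈ maxStencil Ω x → g ∈ activeStencil Ω u x) := by
  have hsum : f + g = e := hp.2.2
  constructor
  · intro hf
    by_contra hfV
    have hn : 1 < ‖toPlane f‖ := by
      by_contra hn
      exact hfV ⟨hf, fun h => absurd h hn⟩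
    obtain ⟨f₁, f₂, hf12⟩ := exists_parentPair hf.1 hn
    obtain ⟨⟨m1, m2⟩, hle⟩ := (notMem_activeStencil_iff hf hf12).mp hfV
    obtain ⟨k, hk, hg⟩ := hp.exists_right_eq hf12
    have hs : f₁ + f₂ = f := hf12.2.2
    obtain ⟨r1, r2⟩ := parallelogram_step hu hk (by rw [← hs, add_comm]) hg hsum.symm m2 m1
      he.1.2 (by linarith)
    exact (notMem_activeStencil_iff he.1 hp).mpr ⟨⟨hf.2, r1⟩, r2⟩ he
  · intro hg
    by_contra hgV
    have hn : 1 < ‖toPlane g‖ := by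
      by_contra hn
      exact hgV ⟨hg, fun h => absurd h hn⟩
    obtain ⟨g₁, g₂, hg12⟩ := exists_parentPair hg.1 hn
    obtain ⟨⟨m1, m2⟩, hle⟩ := (notMem_activeStencil_iff hg hg12).mp hgV
    obtain ⟨k, hk, hf⟩ := hp.exists_left_eq hg12
    have hs : g₁ + g₂ = g := hg12.2.2
    obtain ⟨r1, r2⟩ := parallelogram_step hu hk hs.symm hf (by rw [← hsum, add_comm]) m1 m2
      he.1.2 hle
    exact (notMem_activeStencil_iff he.1 hp).mpr ⟨⟨r1, hg.2⟩, by linarith⟩ he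

theorem toPlane_add (f g : Lattice) : toPlane (f + g) = toPlane f + toPlane g := by
  ext i
  fin_cases i <;> simp [toPlane]

/-- An inactive vector is the sum of two strictly shorter vectors of the maximal stencil, so
induction on the squared norm applies. -/
theorem toPlane_mem_hull_activeStencil (x : grid Ω) (n : ℕ) :
    ∀ e ∈ maxStencil Ω x, dot e e < n →
      toPlane e ∈ PointedCone.hull ℝ (toPlane '' activeStencil Ω u x) := by
  induction n with
  | zero =>
    intro e he h
    have := one_le_dot_self he.1.ne_zero
    simp only [Nat.cast_zero] at h
    omega
  | succ n ih =>
    intro e he h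
    by_cases heV : e ∈ activeStencil Ω u x
    · exact Submodule.subset_span ⟨e, heV, rfl⟩
    have hn : 1 < ‖toPlane e‖ := by
      by_contra hn
      exact heV ⟨he, fun h => absurd h hn⟩
    obtain ⟨f, g, hp⟩ := exists_parentPair he.1 hn
    obtain ⟨⟨hf, hg⟩, -⟩ := (notMem_activeStencil_iff he hp).mp heV
    have hsum : f + g = e := hp.2.2
    have h1 := hp.dot_left_lt
    have h2 := hp.dot_right_lt
    push_cast at h
    rw [← hsum, toPlane_add]
    exact add_mem (ih f ⟨hp.irred_left, hf⟩ (by omega)) (ih g ⟨hp.irred_right, hg⟩ (by omega))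

theorem isStencils_activeStencil (hu : u ∈ convGrid Ω) : IsStencils Ω (activeStencil Ω u) where
  subset_max _ _ he := he.1
  stability x e he hn f hf hfe := by
    have := activeStencil_stable hu he (parents_spec he.1.1 hn)
    rcases hfe with rfl | rfl
    · exact this.1 hf
    · exact this.2 hf
  visibility x := by
    apply le_antisymm
    · exact Submodule.span_mono (Set.image_mono fun _ he => he.1)
    · refine Submodule.span_le.mpr ?_
      rintro _ ⟨e, he, rfl⟩
      exact toPlane_mem_hull_activeStencil x (dot e e + 1).toNat e he (by omega)

theorem mem_convStencils_activeStencil (hu : u ∈ convGrid Ω) :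
    u ∈ convStencils Ω (activeStencil Ω u) := by
  intro x
  refine ⟨fun e he h => evalForm_segForm_nonneg hu he.1.1 h,
    fun e he hn h => evalForm_triForm_nonneg hu (parents_spec he.1.1 hn) h, ?_⟩
  rintro e ⟨he, heV, hn, -⟩
  by_contra hc
  exact heV ⟨he, fun _ => Or.inr (not_le.mp hc)⟩

/-! ### Minimality -/

/-- The sum of a basis belongs to the maximal stencil if a vector of its open cone does. -/
theorem add_mem_maxStencil (hΩ : Convex ℝ Ω) {x : grid Ω} {f g e : Lattice} {a b : ℤ}
    (hdet : det f g = 1) (hf : f ∈ maxStencil Ω x) (hg : g ∈ maxStencil Ω x)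
    (he : e ∈ maxStencil Ω x) (ha : 0 < a) (hb : 0 < b) (hab : e = a • f + b • g) :
    f + g ∈ maxStencil Ω x := by
  refine ⟨(irred_of_det_eq_one (f := f) (g := f + g) ?_).2, ?_⟩
  · simp only [det, Prod.fst_add, Prod.snd_add] at *
    linarith
  have hx : (x : Lattice) + (0 : Lattice) ∈ grid Ω := by simp
  -- The sum `f + g` lies in the triangle with vertices `0`, `e` and one of `f`, `g`, the one with
  -- the smaller coefficient in `e`.
  rcases le_total a b with h | h
  · exact mem_grid_of_weights hΩ he.2 hf.2 hx (a := 1) (b := b - a) (c := a - 1) zero_le_one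
      (by omega) (by omega) (by omega) (by rw [hab]; module)
  · exact mem_grid_of_weights hΩ he.2 hg.2 hx (a := 1) (b := a - b) (c := b - 1) zero_le_one
      (by omega) (by omega) (by omega) (by rw [hab]; module)

theorem eq_add_of_coeff_eq {f g e : Lattice} {a : ℤ} (he : IsIrred e) (ha : 0 < a)
    (h : e = a • f + a • g) : e = f + g := by
  rw [← smul_add] at h
  rcases he.isUnit_of_eq_smul h with rfl | rfl
  · simpa using h
  · omega

/-- Stern-Brocot descent towards `e`: the next mediant has the inactive `f + g` as a parent, so it
is inactive too. The sum of the coefficients decreases until both equal one. -/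
theorem notMem_activeStencil_of_cone (hu : u ∈ convGrid Ω) {x : grid Ω} {e : Lattice}
    (he : e ∈ maxStencil Ω x) (n : ℕ) :
    ∀ (f g : Lattice) (a b : ℤ), IsParentPair (f + g) (f, g) → f ∈ maxStencil Ω x →
      g ∈ maxStencil Ω x → f + g ∉ activeStencil Ω u x → 0 < a → 0 < b → a + b < n →
      e = a • f + b • g → e ∉ activeStencil Ω u x := by
  have hΩ : Convex ℝ Ω := hu.choose_spec.1.1
  induction n with
  | zero => intro f g a b _ _ _ _ ha hb hn; simp only [Nat.cast_zero] at hn; omega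
  | succ n ih =>
    intro f g a b hp hf hg hfg ha hb hn hab
    push_cast at hn
    have hs := add_mem_maxStencil hΩ hp.1 hf hg he ha hb hab
    rcases lt_trichotomy a b with h | h | h
    · have hab' : e = a • (f + g) + (b - a) • g := by rw [hab]; module
      refine ih (f + g) g a (b - a) hp.add_left hs hg (fun hc => hfg ?_) ha (by omega) (by omega)
        hab'
      exact (activeStencil_stable hu hc hp.add_left).1 hs
    · subst h
      rwa [eq_add_of_coeff_eq he.1 ha hab]
    · have hab' : e = (a - b) • f + b • (f + g) := by rw [hab]; module
      refine ih f (f + g) (a - b) b hp.add_right hf hs (fun hc => hfg ?_) (by omega) hb (by omega)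
        hab'
      exact (activeStencil_stable hu hc hp.add_right).2 hs

/-! ### Comparison with an arbitrary admissible family -/

variable {W : grid Ω → Set Lattice}

theorem IsStencils.parents_mem (hW : IsStencils Ω W) {x : grid Ω} {e f g : Lattice} (he : e ∈ W x)
    (hp : IsParentPair e (f, g)) :
    (x + f ∈ grid Ω → f ∈ W x) ∧ (x + g ∈ grid Ω → g ∈ W x) := by
  constructor <;> intro h
  · exact hW.stability x e he hp.one_lt_norm f ⟨hp.irred_left, h⟩ (by simp [hp.parents_eq])
  · exact hW.stability x e he hp.one_lt_norm g ⟨hp.irred_right, h⟩ (by simp [hp.parents_eq])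

/-- Let `p, q` be members of a stencil with `0 < d = det p q`. Unless `p, q` is an acute basis, a
parent of the longer one cuts the cone of `p` and `q`. -/
theorem exists_parent_between {p q : Lattice} {d : ℤ} (hp : IsIrred p) (hq : IsIrred q) (hd : 0 < d)
    (hdet : det p q = d) (hpq : 1 < d ∨ dot p q < 0) :
    ∃ (r : Lattice) (l m : ℤ), d • r = l • p + m • q ∧
      (1 < d → 0 < l ∧ 0 < m ∧ l + m ≤ d) ∧ (d = 1 → r = p + q) ∧
      ((∃ s, IsParentPair q (r, s)) ∨ ∃ s, IsParentPair p (s, r)) := by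
  have hbound : ∀ v w : Lattice, dot v w * dot v w + det v w * det v w = dot v v * dot w w := by
    intro v w; simp only [dot, det]; ring
  -- This ensures that the longer of the two vectors is not a unit vector and so has parents.
  have hlong : 1 < dot p p * dot q q := by
    rw [← hbound, hdet]
    rcases hpq with h | h <;> nlinarith [mul_self_nonneg (dot p q)]
  have hp1 := one_le_dot_self hp.ne_zero
  have hq1 := one_le_dot_self hq.ne_zero
  rcases le_total (dot p p) (dot q q) with hle | hle
  · have hn : 1 < ‖toPlane q‖ := by
      rw [one_lt_norm_iff]
      by_contra hc
      nlinarith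
    obtain ⟨f, g, hfg⟩ := exists_parentPair hq hn
    have e1 := hfg.dot_add
    have e2 := hfg.dot_right_pos
    obtain ⟨m, hm, h1, h2⟩ := exists_smul_parent_eq (σ := 1) hp hq (by norm_num) hd
      (by rw [hdet, one_mul]) hfg.det_left hfg.dot_left_pos (by omega) hle
    refine ⟨f, 1, m, by simpa using hm, fun h => ?_, fun h => ?_, Or.inl ⟨g, hfg⟩⟩
    · obtain ⟨h3, h4⟩ := h1 h
      exact ⟨one_pos, h3, by omega⟩
    · have := h2 h (hpq.resolve_left (by omega))
      subst h this
      simpa using hm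
  · have hn : 1 < ‖toPlane p‖ := by
      rw [one_lt_norm_iff]
      by_contra hc
      nlinarith
    obtain ⟨f, g, hfg⟩ := exists_parentPair hp hn
    have e1 := hfg.dot_add
    have e2 := hfg.dot_left_pos
    have anti : ∀ v w, det v w = - det w v := by intro v w; simp only [det]; ring
    have comm : dot q p = dot p q := by simp only [dot]; ring
    obtain ⟨m, hm, h1, h2⟩ := exists_smul_parent_eq (σ := -1) hq hp (by norm_num) hd
      (by rw [anti, hdet]; ring) (by rw [anti, hfg.det_right]) hfg.dot_right_pos (by omega) hle
    refine ⟨g, m, 1, by rw [hm]; module, fun h => ?_, fun h => ?_, Or.inr ⟨f, hfg⟩⟩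
    · obtain ⟨h3, h4⟩ := h1 h
      exact ⟨h3, one_pos, by omega⟩
    · have := h2 h (by rw [comm]; exact hpq.resolve_left (by omega))
      subst h this
      rw [one_smul, one_smul] at hm
      rw [hm, add_comm]

/-- In the cone of a basis contained in a stencil. -/
theorem notMem_activeStencil_of_basis (hu : u ∈ convGrid Ω) (hW : IsStencils Ω W)
    (huW : u ∈ convStencils Ω W) {x : grid Ω} {e : Lattice} (he : e ∈ maxStencil Ω x)
    (heW : e ∉ W x) (n : ℕ) :
    ∀ (f g : Lattice) (a b : ℤ), det f g = 1 → f ∈ W x → g ∈ W x → 0 < a → 0 < b → a + b < n →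
      e = a • f + b • g → e ∉ activeStencil Ω u x := by
  have hΩ : Convex ℝ Ω := hu.choose_spec.1.1
  induction n with
  | zero => intro f g a b _ _ _ ha hb hn; simp only [Nat.cast_zero] at hn; omega
  | succ n ih =>
    intro f g a b hdet hf hg ha hb hn hab
    push_cast at hn
    have hs := add_mem_maxStencil hΩ hdet (hW.subset_max x hf) (hW.subset_max x hg) he ha hb hab
    by_cases hfg : f + g ∈ W x
    · rcases lt_trichotomy a b with h | h | h
      · refine ih (f + g) g a (b - a) ?_ hfg hg ha (by omega) (by omega) (by rw [hab]; module)
        simp only [det, Prod.fst_add, Prod.snd_add] at *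
        linarith
      · subst h
        exact absurd (eq_add_of_coeff_eq he.1 ha hab ▸ hfg) heW
      · refine ih f (f + g) (a - b) b ?_ hf hfg (by omega) hb (by omega) (by rw [hab]; module)
        simp only [det, Prod.fst_add, Prod.snd_add] at *
        linarith
    -- If the angle were obtuse, `f + g` would be a parent of `f` or of `g`, hence in `W x` by
    -- stability.
    · have hdot : 0 ≤ dot f g := by
        by_contra hc
        obtain ⟨r, -, -, -, -, hr, hpar⟩ := exists_parent_between (hW.subset_max x hf).1
          (hW.subset_max x hg).1 one_pos hdet (Or.inr (not_le.mp hc))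
        rw [hr rfl] at hpar
        rcases hpar with ⟨s, hpar⟩ | ⟨s, hpar⟩
        · exact hfg ((hW.parents_mem hg hpar).1 hs.2)
        · exact hfg ((hW.parents_mem hf hpar).2 hs.2)
      have hp : IsParentPair (f + g) (f, g) := ⟨hdet, hdot, rfl⟩
      have hcand : f + g ∈ candidates Ω W x :=
        ⟨hs, hfg, hp.one_lt_norm, by simpa [hp.parents_eq] using hf,
          by simpa [hp.parents_eq] using hg⟩
      have hpos := (huW x).2.2 _ hcand
      rw [evalForm_parForm hp] at hpos
      have hnot : f + g ∉ activeStencil Ω u x :=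
        (notMem_activeStencil_iff hs hp).mpr
          ⟨⟨(hW.subset_max x hf).2, (hW.subset_max x hg).2⟩, by linarith⟩
      exact notMem_activeStencil_of_cone hu he _ f g a b hp (hW.subset_max x hf)
        (hW.subset_max x hg) hnot ha hb hn hab

/-- Induction on `det p q`: the parent `r` splits the cone into two of smaller determinant, and `e`,
which differs from `r`, is interior to one of them. -/
theorem notMem_activeStencil_of_between (hu : u ∈ convGrid Ω) (hW : IsStencils Ω W)
    (huW : u ∈ convStencils Ω W) {x : grid Ω} {e : Lattice} (he : e ∈ maxStencil Ω x)
    (heW : e ∉ W x) (n : ℕ) :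
    ∀ p q : Lattice, p ∈ W x → q ∈ W x → 0 < det p q → det p q < n → 0 < det p e → 0 < det e q →
      e ∉ activeStencil Ω u x := by
  have hΩ : Convex ℝ Ω := hu.choose_spec.1.1
  induction n with
  | zero => intro p q _ _ h hn; simp only [Nat.cast_zero] at hn; omega
  | succ n ih =>
    intro p q hp hq hd hn hpe heq
    push_cast at hn
    rcases (show det p q = 1 ∨ 1 < det p q by omega) with h1 | h1
    · exact notMem_activeStencil_of_basis hu hW huW he heW (det e q + det p e + 1).toNat p q _ _ h1
        hp hq heq hpe (by omega) (eq_smul_add_smul h1 e)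
    · have hpM := hW.subset_max x hp
      have hqM := hW.subset_max x hq
      obtain ⟨r, l, m, hr, hlm, -, hpar⟩ :=
        exists_parent_between hpM.1 hqM.1 hd rfl (Or.inl h1)
      obtain ⟨hl, hm, hsum⟩ := hlm h1
      have hx : (x : Lattice) + (0 : Lattice) ∈ grid Ω := by simp
      -- Since `l + m ≤ det p q`, the vector `r` lies in the triangle with vertices `0`, `p`, `q`.
      have hxr : (x : Lattice) + r ∈ grid Ω := by
        refine mem_grid_of_weights hΩ hpM.2 hqM.2 hx (a := l) (b := m) (c := det p q - l - m)
          hl.le hm.le (by omega) (by omega) ?_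
        rw [show l + m + (det p q - l - m) = det p q by ring, smul_add, hr]
        module
      have hrW : r ∈ W x := by
        rcases hpar with ⟨s, hpar⟩ | ⟨s, hpar⟩
        · exact (hW.parents_mem hq hpar).1 hxr
        · exact (hW.parents_mem hp hpar).2 hxr
      have e1 := congrArg Prod.fst hr
      have e2 := congrArg Prod.snd hr
      simp only [Prod.fst_add, Prod.snd_add, Prod.smul_fst, Prod.smul_snd, smul_eq_mul] at e1 e2
      have d1 : det p r = m := by
        refine mul_left_cancel₀ hd.ne' ?_
        calc det p q * det p r = p.1 * (det p q * r.2) - p.2 * (det p q * r.1) := by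
              simp only [det]; ring
          _ = det p q * m := by rw [e1, e2]; simp only [det]; ring
      have d2 : det r q = l := by
        refine mul_left_cancel₀ hd.ne' ?_
        calc det p q * det r q = (det p q * r.1) * q.2 - (det p q * r.2) * q.1 := by
              simp only [det]; ring
          _ = det p q * l := by rw [e1, e2]; simp only [det]; ring
      rcases lt_trichotomy (det r e) 0 with h | h | h
      · exact ih p r hp hrW (by omega) (by omega) hpe (by simp only [det] at *; linarith)
      · have := eq_of_det_eq_zero (hW.subset_max x hrW).1 he.1 h (v := p) (by omega) hpe
        exact absurd (this ▸ hrW) heW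
      · exact ih r q hrW hq (by omega) (by omega) h heq

/-- A vector of the cone of a stencil, not in the stencil, lies strictly between two of its
members. -/
theorem exists_between_of_mem_hull {S : Set Lattice} (hS : ∀ w ∈ S, IsIrred w) {e : Lattice}
    (he : IsIrred e) (heS : e ∉ S) (hmem : toPlane e ∈ PointedCone.hull ℝ (toPlane '' S)) :
    ∃ p ∈ S, ∃ q ∈ S, 0 < det p q ∧ 0 < det p e ∧ 0 < det e q := by
  by_contra hcon
  push Not at hcon
  obtain ⟨n, c, w, hsum⟩ := Submodule.mem_span_set'.mp hmem
  choose v hvS hv using fun i => (w i).2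
  have hc : ∀ i, (0 : ℝ) ≤ (c i : ℝ) := fun i => (c i).2
  have hsum' : ∑ i, (c i : ℝ) • toPlane (v i) = toPlane e := by
    rw [← hsum]
    exact Finset.sum_congr rfl fun i _ => by rw [hv]; rfl
  have s1 : ∑ i, (c i : ℝ) * (v i).1 = e.1 := by
    have h := congrArg (fun z : Plane => z 0) hsum'
    simp only [toPlane, WithLp.ofLp_sum, WithLp.ofLp_smul, Finset.sum_apply, Pi.smul_apply] at h
    exact h
  have s2 : ∑ i, (c i : ℝ) * (v i).2 = e.2 := by
    have h := congrArg (fun z : Plane => z 1) hsum'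
    simp only [toPlane, WithLp.ofLp_sum, WithLp.ofLp_smul, Finset.sum_apply, Pi.smul_apply] at h
    exact h
  have sdet : ∀ z : Lattice, ∑ i, (c i : ℝ) * (det z (v i) : ℤ) = (det z e : ℤ) := by
    intro z
    simp only [det]
    push_cast
    rw [← s1, ← s2, Finset.mul_sum, Finset.mul_sum, ← Finset.sum_sub_distrib]
    exact Finset.sum_congr rfl fun i _ => by ring
  have sdot : ∀ z : Lattice, ∑ i, (c i : ℝ) * (dot z (v i) : ℤ) = (dot z e : ℤ) := by
    intro z
    simp only [dot]
    push_cast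
    rw [← s1, ← s2, Finset.mul_sum, Finset.mul_sum, ← Finset.sum_add_distrib]
    exact Finset.sum_congr rfl fun i _ => by ring
  have hee := one_le_dot_self he.ne_zero
  have hzero : ∀ i, det e (v i) = 0 → v i = -e := by
    intro i hi
    rcases eq_or_eq_neg_of_det_eq_zero he (hS _ (hvS i)) hi with h | h
    · exact absurd (h ▸ hvS i) heS
    · rw [h, neg_neg]
  have dotneg : dot e (-e) = -dot e e := by
    simp only [dot, Prod.fst_neg, Prod.snd_neg]; ring
  have lag : ∀ i j, dot e e * det (v j) (v i) =
      dot e (v j) * det e (v i) - det e (v j) * dot e (v i) := by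
    intro i j; simp only [dot, det]; ring
  -- Among the generators clockwise of `e`, take the one closest in angle, by maximizing the
  -- cotangent. If no pair encloses `e`, no generator lies strictly counterclockwise of this `v j`
  -- (`hle`), whereas their combination `e` does.
  by_cases hR : ∃ j, det e (v j) < 0
  · obtain ⟨j, hj, hmax⟩ := (Finset.univ.filter fun j => det e (v j) < 0).exists_max_image
      (fun j => (dot e (v j) : ℚ) / (-det e (v j) : ℤ)) (by simpa [Finset.Nonempty] using hR)
    simp only [Finset.mem_filter, Finset.mem_univ, true_and] at hj hmax
    have anti : det (v j) e = -det e (v j) := by simp only [det]; ring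
    have hle : ∀ i, det (v j) (v i) ≤ 0 := by
      intro i
      rcases lt_trichotomy (det e (v i)) 0 with h | h | h
      · have := hmax i h
        rw [div_le_div_iff₀ (by exact_mod_cast neg_pos.mpr h)
          (by exact_mod_cast neg_pos.mpr hj)] at this
        have this' : dot e (v i) * -det e (v j) ≤ dot e (v j) * -det e (v i) := by
          exact_mod_cast this
        have := lag i j
        nlinarith
      · have h1 : det (v j) (v i) = -det (v j) e := by
          rw [hzero i h]; simp only [det, Prod.fst_neg, Prod.snd_neg]; ring
        omega
      · by_contra hpos
        have := hcon (v j) (hvS j) (v i) (hvS i) (not_le.mp hpos) (by omega)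
        omega
    have h1 : ((det (v j) e : ℤ) : ℝ) ≤ 0 := by
      rw [← sdet]
      exact Finset.sum_nonpos fun i _ =>
        mul_nonpos_of_nonneg_of_nonpos (hc i) (by exact_mod_cast hle i)
    have h2 : det (v j) e ≤ 0 := by exact_mod_cast h1
    omega
  -- With no generator clockwise of `e`, only those collinear with `e` carry weight. They equal
  -- `-e`, which contradicts `dot e e > 0`.
  · push Not at hR
    have hself : det e e = 0 := by simp only [det]; ring
    have h0 := sdet e
    rw [hself, Int.cast_zero, Finset.sum_eq_zero_iff_of_nonneg fun i _ =>
      mul_nonneg (hc i) (by exact_mod_cast hR i)] at h0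
    have h1 : ((dot e e : ℤ) : ℝ) ≤ 0 := by
      rw [← sdot]
      refine Finset.sum_nonpos fun i hi => ?_
      rcases mul_eq_zero.mp (h0 i hi) with h | h
      · rw [h, zero_mul]
      · rw [hzero i (by exact_mod_cast h), dotneg]
        refine mul_nonpos_of_nonneg_of_nonpos (hc i) ?_
        exact_mod_cast (by omega : -dot e e ≤ 0)
    have h2 : dot e e ≤ 0 := by exact_mod_cast h1
    omega

theorem activeStencil_subset (hu : u ∈ convGrid Ω) (hW : IsStencils Ω W)
    (huW : u ∈ convStencils Ω W) (x : grid Ω) : activeStencil Ω u x ⊆ W x := by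
  intro e heV
  by_contra heW
  have hmem : toPlane e ∈ PointedCone.hull ℝ (toPlane '' W x) := by
    rw [hW.visibility x]
    exact Submodule.subset_span ⟨e, heV.1, rfl⟩
  obtain ⟨p, hp, q, hq, h1, h2, h3⟩ :=
    exists_between_of_mem_hull (fun w hw => (hW.subset_max x hw).1) heV.1.1 heW hmem
  exact notMem_activeStencil_of_between hu hW huW heV.1 heW (det p q + 1).toNat p q hp hq h1
    (by omega) h2 h3 heV

theorem isMinimalStencils_activeStencil (hu : u ∈ convGrid Ω) :
    IsMinimalStencils Ω u (activeStencil Ω u) :=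
  ⟨⟨isStencils_activeStencil hu, mem_convStencils_activeStencil hu⟩,
    fun _ hW x => activeStencil_subset hu hW.1 hW.2 x⟩

end Convexity

end DiscreteConvex

theorem mainTheorem5 (Ω : Set DiscreteConvex.Plane) (hconv : Convex ℝ Ω) (hcomp : IsCompact Ω)
    (u : DiscreteConvex.grid Ω → ℝ) (hu : u ∈ DiscreteConvex.convGrid Ω) :
    (∃ V, DiscreteConvex.IsMinimalStencils Ω u V) ∧
    ∀ V, DiscreteConvex.IsMinimalStencils Ω u V →
      ∀ x : DiscreteConvex.grid Ω, ∀ e : DiscreteConvex.Lattice,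
        DiscreteConvex.IsIrred e → 1 < ‖DiscreteConvex.toPlane e‖ →
        (x : DiscreteConvex.Lattice) + e ∈ DiscreteConvex.grid Ω →
        (e ∈ V x ↔
          (¬ DiscreteConvex.SupportedOn (DiscreteConvex.parForm x e) (DiscreteConvex.grid Ω) ∨
            DiscreteConvex.evalForm (DiscreteConvex.parForm x e) u < 0)) := by
  have hmin := DiscreteConvex.isMinimalStencils_activeStencil hu
  refine ⟨⟨_, hmin⟩, fun V hV x e he hn hxe => ?_⟩
  rw [hV.unique hmin]
  exact ⟨fun h => h.2 hn, fun h => ⟨⟨he, hxe⟩, fun _ => h⟩⟩
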